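/- **Theorem 1.** Let $A\in\mathbb{R}^{n\times n}$, $C\in\mathbb{R}^{m\times n}$, let $\Sigma_w\succeq 0$ and $\Sigma_v\succ 0$ be symmetric, let $(A,C)$ be detectable and $(A,\sqrt{\Sigma_w})$ stabilizable. Let $\overline P\succeq 0$ be the steady-state filtered error covariance of the Kalman filter, i.e. $\overline P=M-MC^\top(CMC^\top+\Sigma_v)^{-1}CM$ with $M=A\overline PA^\top+\Sigma_w$, and put $$P(\tau)=A^{\tau}\overline P(A^\top)^{\tau}+\sum_{t=0}^{\tau-1}A^t\Sigma_w(A^\top)^t,\qquad \tau\in\mathbb{N}=\{0,1,2,\dots\}.$$ Let $r_s\in[0,1]$ (the known success rate of the channel) and $\lambda\ge 0$ (the cost of one transmission). Consider the Markov decision process with states $\tau\in\mathbb{N}$, actions $a\in\{0,1\}$, transitions $$\Pr(0\mid\tau,1)=r_s,\quad \Pr(\tau+1\mid\tau,1)=1-r_s,\quad \Pr(\tau+1\mid\tau,0)=1,$$ and one-stage cost $c(\tau,a)=\operatorname{Tr}P(\tau)+\lambda a$, started at $\tau(0)=0$. An admissible policy $f=(f_k)_{k\ge 0}$ chooses $a(k)=f_k(\tau(0),\dots,\tau(k),a(0),\dots,a(k-1))$.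 Let $$J_e(f)=\limsup_{T\to\infty}\frac1T\,\mathbb{E}^f\sum_{k=0}^{T-1}\operatorname{Tr}P(\tau(k)),\qquad J_r(f)=\limsup_{T\to\infty}\frac1T\,\mathbb{E}^f\sum_{k=0}^{T-1}a(k),$$ $$J(f)=\limsup_{T\to\infty}\frac1T\,\mathbb{E}^f\sum_{k=0}^{T-1}c(\tau(k),a(k)).$$ Assume $\rho(A)^2(1-r_s)<1$, where $\rho$ is the spectral radius. Then there is a real number $\mathcal J^\star\ge 0$ that is both the minimum of $J_e(f)+\lambda J_r(f)$ (Problem 1) and the minimum of $J(f)$ over all admissible policies $f$, and there is a function $V:\mathbb{N}\to\mathbb{R}$, bounded below, that solves the Bellman optimality equation $$V(\tau)=\min_{a\in\{0,1\}}Q(\tau,a),\qquad Q(\tau,a)=c(\tau,a)+\sum_{\tau_+}V(\tau_+)\Pr(\tau_+\mid\tau,a)-\mathcal J^\star .$$ Moreover, for every such $V$: 1. $V$ is nondecreasing, $Q(\tau,1)-Q(\tau,0)=\lambda+r_sV(0)-r_sV(\tau+1)$ for all $\tau$, and this difference is nonincreasing in $\tau$. 2. The policy $f^\star$ that chooses an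 action minimizing $Q(\tau,\cdot)$, and $a=1$ if both actions do, is a stationary deterministic threshold policy: there is $\theta^\star\in\mathbb{N}\cup\{\infty\}$ such that $f^\star(\tau)=1$ if $\tau\ge\theta^\star$ and $f^\star(\tau)=0$ if $\tau<\theta^\star$ (for $\theta^\star=\infty$ it never transmits). This policy is optimal: $J_e(f^\star)+\lambda J_r(f^\star)=J(f^\star)=\mathcal J^\star$. 3. If $\rho(A)\ge 1$, then $\theta^\star<\infty$. -/

import Mathlib

open Filter Topology
open scoped ENNReal Matrix

namespace SensorScheduling

/-! ### The linear system and the estimation error covariance -/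

/-- The spectral radius of a real square matrix: the largest modulus of its complex eigenvalues. -/
noncomputable def specRadius {n : ℕ} (A : Matrix (Fin n) (Fin n) ℝ) : ℝ≥0∞ :=
  spectralRadius ℂ (A.map Complex.ofReal)

/-- `(A, B)` is stabilizable: some state feedback makes the closed loop Schur stable. -/
def Stabilizable {n p : ℕ} (A : Matrix (Fin n) (Fin n) ℝ) (B : Matrix (Fin n) (Fin p) ℝ) : Prop :=
  ∃ K : Matrix (Fin p) (Fin n) ℝ, specRadius (A + B * K) < 1

/-- `(A, C)` is detectable: some output injection makes the error dynamics Schur stable. -/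
def Detectable {n m : ℕ} (A : Matrix (Fin n) (Fin n) ℝ) (C : Matrix (Fin m) (Fin n) ℝ) : Prop :=
  ∃ L : Matrix (Fin n) (Fin m) ℝ, specRadius (A + L * C) < 1

/-- Time update of an error covariance. -/
noncomputable def predictCov {n : ℕ} (A W P : Matrix (Fin n) (Fin n) ℝ) :
    Matrix (Fin n) (Fin n) ℝ :=
  A * P * Aᵀ + W

/-- Measurement update of an error covariance in the Kalman filter. -/
noncomputable def correctCov {n m : ℕ} (C : Matrix (Fin m) (Fin n) ℝ)
    (R : Matrix (Fin m) (Fin m) ℝ) (M : Matrix (Fin n) (Fin n) ℝ) : Matrix (Fin n) (Fin n) ℝ :=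
  M - M * Cᵀ * (C * M * Cᵀ + R)⁻¹ * C * M

/-- `P` is a steady state of the (filtered) error covariance of the Kalman filter: a covariance
matrix that is reproduced by a time update followed by a measurement update. -/
def IsKalmanSteadyState {n m : ℕ} (A : Matrix (Fin n) (Fin n) ℝ) (C : Matrix (Fin m) (Fin n) ℝ)
    (W : Matrix (Fin n) (Fin n) ℝ) (R : Matrix (Fin m) (Fin m) ℝ)
    (P : Matrix (Fin n) (Fin n) ℝ) : Prop :=
  P.PosSemidef ∧ P = correctCov C R (predictCov A W P)

/-- The error covariance `P(τ)` of the remote estimator when `τ` time steps have elapsed since the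
last successful transmission. -/
noncomputable def remoteCov {n : ℕ} (A W Pbar : Matrix (Fin n) (Fin n) ℝ) (τ : ℕ) :
    Matrix (Fin n) (Fin n) ℝ :=
  A ^ τ * Pbar * Aᵀ ^ τ + ∑ t ∈ Finset.range τ, A ^ t * W * Aᵀ ^ t

/-! ### The Markov decision process

States are elapsed times `τ : ℕ`; the action `true` is "transmit", `false` is "do not transmit". -/

/-- The numerical value `0` or `1` of an action. -/
def actionValue (a : Bool) : ℝ := if a then 1 else 0

/-- The transition probability from `τ` to `s` under action `a`, with success rate `r`. -/
noncomputable def transProb (r : ℝ) (τ : ℕ) (a : Bool) (s : ℕ) : ℝ :=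
  if s = 0 ∧ a = true then r
  else if s = τ + 1 ∧ a = true then 1 - r
  else if s = τ + 1 ∧ a = false then 1
  else 0

theorem hasSum_transProb (r : unitInterval) (τ : ℕ) (a : Bool) :
    HasSum (fun s => ENNReal.ofReal (transProb r τ a s)) 1 := by
  have h : ∑ s ∈ ({0, τ + 1} : Finset ℕ), ENNReal.ofReal (transProb r τ a s) = 1 := by
    rw [Finset.sum_pair (Nat.succ_ne_zero τ).symm]
    cases a
    · simp [transProb]
    · have h1 : (0 : ℝ) ≤ r := r.2.1
      have h2 : (0 : ℝ) ≤ 1 - r := sub_nonneg.2 r.2.2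
      simp [transProb, ← ENNReal.ofReal_add h1 h2]
  rw [← h]
  apply hasSum_sum_of_ne_finset_zero
  intro s hs
  simp only [Finset.mem_insert, Finset.mem_singleton, not_or] at hs
  simp [transProb, hs.1, hs.2]

/-- The law of the next state. -/
noncomputable def transLaw (r : unitInterval) (τ : ℕ) (a : Bool) : PMF ℕ :=
  ⟨fun s => ENNReal.ofReal (transProb r τ a s), hasSum_transProb r τ a⟩

/-- The one-stage cost `Tr P(τ) + lam * a`. -/
noncomputable def stageCost {n : ℕ} (A W Pbar : Matrix (Fin n) (Fin n) ℝ) (lam : ℝ)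
    (τ : ℕ) (a : Bool) : ℝ :=
  (remoteCov A W Pbar τ).trace + lam * actionValue a

/-- Histories at time `k`: the states at times `0, …, k` and the actions at times `0, …, k - 1`. -/
abbrev History (k : ℕ) : Type := (Fin (k + 1) → ℕ) × (Fin k → Bool)

/-- Admissible scheduling policies: the action at time `k` is a function of the history. -/
abbrev Policy : Type := (k : ℕ) → History k → Bool

/-- The law of the history at time `k` under the policy `f`, started from `τ(0) = 0`. -/
noncomputable def historyLaw (r : unitInterval) (f : Policy) : (k : ℕ) → PMF (History k)
  | 0 => PMF.pure (fun _ => 0, fun i => i.elim0)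
  | k + 1 => (historyLaw r f k).bind fun h =>
      (transLaw r (h.1 (Fin.last k)) (f k h)).map fun s =>
        (Fin.snoc h.1 s, Fin.snoc h.2 (f k h))

/-- The expectation under `f` of `g (τ(k)) (a(k))`, the function `g` being nonnegative. -/
noncomputable def expectAt (r : unitInterval) (f : Policy) (g : ℕ → Bool → ℝ) (k : ℕ) : ℝ≥0∞ :=
  ∑' h : History k, historyLaw r f k h * ENNReal.ofReal (g (h.1 (Fin.last k)) (f k h))

/-- The long-run expected average (upper limit) of the nonnegative quantity `g (τ(k)) (a(k))`;
it may be infinite. -/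
noncomputable def longRunAverage (r : unitInterval) (f : Policy) (g : ℕ → Bool → ℝ) : ℝ≥0∞ :=
  limsup (fun T : ℕ => (∑ k ∈ Finset.range T, expectAt r f g k) / (T : ℝ≥0∞)) atTop

/-- The expected average estimation error. -/
noncomputable def errorRate {n : ℕ} (A W Pbar : Matrix (Fin n) (Fin n) ℝ) (r : unitInterval)
    (f : Policy) : ℝ≥0∞ :=
  longRunAverage r f fun τ _ => (remoteCov A W Pbar τ).trace

/-- The expected average transmission rate. -/
noncomputable def commRate (r : unitInterval) (f : Policy) : ℝ≥0∞ :=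
  longRunAverage r f fun _ a => actionValue a

/-- The objective of the costly communication problem: average estimation error plus `lam` times
the transmission rate. -/
noncomputable def totalCost {n : ℕ} (A W Pbar : Matrix (Fin n) (Fin n) ℝ) (lam : ℝ)
    (r : unitInterval) (f : Policy) : ℝ≥0∞ :=
  errorRate A W Pbar r f + ENNReal.ofReal lam * commRate r f

/-- The objective of the average-cost Markov decision process with cost `stageCost`. -/
noncomputable def mdpCost {n : ℕ} (A W Pbar : Matrix (Fin n) (Fin n) ℝ) (lam : ℝ)
    (r : unitInterval) (f : Policy) : ℝ≥0∞ :=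
  longRunAverage r f (stageCost A W Pbar lam)

/-- The stationary deterministic policy given by a decision rule on the current state. -/
def stationary (d : ℕ → Bool) : Policy := fun k h => d (h.1 (Fin.last k))

/-- The threshold rule: transmit exactly when `θ ≤ τ`. With `θ = ⊤` it never transmits. -/
noncomputable def thresholdRule (θ : ℕ∞) (τ : ℕ) : Bool := by
  classical exact decide (θ ≤ (τ : ℕ∞))

/-! ### The Bellman optimality equation -/

/-- The Q-factor of a relative value function `V` and an average cost `J`. The sum has at most two
nonzero terms. -/
noncomputable def qFactor {n : ℕ} (A W Pbar : Matrix (Fin n) (Fin n) ℝ) (lam : ℝ)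
    (r : unitInterval) (J : ℝ) (V : ℕ → ℝ) (τ : ℕ) (a : Bool) : ℝ :=
  stageCost A W Pbar lam τ a + ∑' s : ℕ, V s * transProb r τ a s - J

/-- `V` is a relative value function for the average cost `J`: it is bounded below and solves the
Bellman optimality equation. -/
def IsRelativeValue {n : ℕ} (A W Pbar : Matrix (Fin n) (Fin n) ℝ) (lam : ℝ)
    (r : unitInterval) (J : ℝ) (V : ℕ → ℝ) : Prop :=
  BddBelow (Set.range V) ∧
    ∀ τ, V τ = min (qFactor A W Pbar lam r J V τ false) (qFactor A W Pbar lam r J V τ true)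

/-- The decision rule of the Bellman equation: choose an action that minimizes the Q-factor, and
transmit when both actions do. -/
noncomputable def bellmanRule {n : ℕ} (A W Pbar : Matrix (Fin n) (Fin n) ℝ) (lam : ℝ)
    (r : unitInterval) (J : ℝ) (V : ℕ → ℝ) (τ : ℕ) : Bool := by
  classical
  exact decide (qFactor A W Pbar lam r J V τ true ≤ qFactor A W Pbar lam r J V τ false)

end SensorScheduling

/-! The decision problem sees the system only through e(τ) = Tr P(τ), which is nonnegative,
nondecreasing, and of growth controlled by ρ(A)²(1-r) < 1. It is nondecreasing because P(τ+1) - P(τ)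
= A^τ (M - Pbar) (Aᵀ)^τ, and M - Pbar is the Kalman correction, hence ⪰ 0
(`posSemidef_predictCov_sub`).

Existence: normalize V(0) = 0. For r < 1 the Bellman equation can be solved forwards for every J,
and the optimal J is the least one whose solution stays nonnegative
(`exists_bellmanSolvable_of_lt_one`). For r = 1 it is the infimum of the cost rates of renewal
cycles (`exists_bellmanSolvable_one`).

Verification: telescoping V, which is bounded below, bounds the cost of the minimizing rule from
above. V may be unbounded, so the lower bound for an arbitrary policy uses bounded subsolutions for
each J' < J and then J' → J.

Structure: a solution bounded below cannot decrease, since a descent would perpetuate itself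
(`monotone_of_bellman`); this yields the threshold. Subadditivity of limsup gives J(f) ≤ J_e(f) + λ
J_r(f); under a threshold rule the transmission rate is a true limit, so the sum is also at most the
optimal J. If transmission never pays, Tr P(τ) ≤ J for all τ; then a left eigenvector of a mode with
|μ| ≥ 1 annihilates the noise, against stabilizability (`specRadius_lt_one_of_trace_le`). -/

namespace SensorScheduling

/-! ### The Bellman equation for an abstract nondecreasing cost -/

/-- The minimum over the two actions of the expected continuation value, plus the transmission
cost: `y` is the value of staying silent, `v` the value right after a success. -/
noncomputable def contValue (lam r v y : ℝ) : ℝ := min y (lam + r * v + (1 - r) * y)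

theorem contValue_mono {lam r v x y : ℝ} (hr1 : r ≤ 1) (h : x ≤ y) :
    contValue lam r v x ≤ contValue lam r v y := by
  unfold contValue
  have : (1 - r) * x ≤ (1 - r) * y := mul_le_mul_of_nonneg_left h (by linarith)
  exact min_le_min h (by linarith)

theorem contValue_sub_le {lam r v x y : ℝ} (hr0 : 0 ≤ r) (h : x ≤ y) :
    contValue lam r v y ≤ contValue lam r v x + (y - x) := by
  unfold contValue
  rcases min_cases x (lam + r * v + (1 - r) * x) with ⟨h1, -⟩ | ⟨h1, -⟩ <;> rw [h1]
  · exact (min_le_left _ _).trans (by linarith)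
  · refine (min_le_right _ _).trans ?_
    nlinarith [mul_nonneg hr0 (sub_nonneg.2 h)]

/-- As e does not decrease, a drop of V must come from a drop of the continuation value. That map is
increasing and 1-Lipschitz, so the next drop of V is at least as large, and V falls to -∞ at least
linearly. -/
theorem monotone_of_bellman {e V : ℕ → ℝ} {lam r J : ℝ} (he : Monotone e) (hr0 : 0 ≤ r)
    (hr1 : r ≤ 1) (hbdd : BddBelow (Set.range V))
    (hV : ∀ τ, V τ = e τ - J + contValue lam r (V 0) (V (τ + 1))) : Monotone V := by
  refine monotone_nat_of_le_succ fun τ => ?_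
  by_contra! hlt
  have key : ∀ k, V (τ + k + 1) - V (τ + k) ≤ V (τ + 1) - V τ := by
    intro k
    induction k with
    | zero => simp
    | succ k ih =>
      have h1 := hV (τ + k)
      have h2 := hV (τ + k + 1)
      have h3 := he (Nat.le_succ (τ + k))
      have h4 : V (τ + k + 1 + 1) ≤ V (τ + k + 1) := by
        by_contra! h
        have := contValue_mono (lam := lam) (v := V 0) hr1 h.le
        simp only [Nat.succ_eq_add_one] at h3
        linarith
      have h5 := contValue_sub_le (lam := lam) (v := V 0) hr0 h4
      simp only [Nat.succ_eq_add_one] at h3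
      rw [← add_assoc]
      linarith
  have key2 : ∀ k : ℕ, V (τ + k) ≤ V τ + k * (V (τ + 1) - V τ) := by
    intro k
    induction k with
    | zero => simp
    | succ k ih =>
      have := key k
      rw [← add_assoc]
      push_cast
      linarith
  obtain ⟨b, hb⟩ := hbdd
  obtain ⟨k, hk⟩ := exists_nat_gt ((V τ - b) / (V τ - V (τ + 1)))
  rw [div_lt_iff₀ (by linarith)] at hk
  have := hb ⟨τ + k, rfl⟩
  have := key2 k
  linarith

/-! ### Solvability for a success rate below one -/

/-- The solution of the Bellman equation with constant `J` that vanishes at `0`, computed forwards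
(for a success rate below `1`). -/
noncomputable def forwardValue (e : ℕ → ℝ) (lam r J : ℝ) : ℕ → ℝ
  | 0 => 0
  | t + 1 => max (forwardValue e lam r J t + J - e t)
      ((forwardValue e lam r J t + J - e t - lam) / (1 - r))

/-- `contValue lam r 0` is the minimum of two lines of positive slopes 1 and 1 - r, so its inverse
is the maximum of the two inverse lines. -/
theorem forwardValue_bellman {e : ℕ → ℝ} {lam r J : ℝ} (hr1 : r < 1) (t : ℕ) :
    forwardValue e lam r J t
      = e t - J + contValue lam r 0 (forwardValue e lam r J (t + 1)) := by
  have hq : 0 < 1 - r := by linarith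
  have h : ∀ y : ℝ, contValue lam r 0 (max y ((y - lam) / (1 - r))) = y := by
    intro y
    unfold contValue
    rcases le_total ((y - lam) / (1 - r)) y with h1 | h1
    · rw [max_eq_left h1]
      rw [div_le_iff₀ hq] at h1
      exact min_eq_left (by linarith)
    · rw [max_eq_right h1, mul_div_cancel₀ _ hq.ne', min_eq_right (by linarith)]
      ring
  rw [forwardValue, h]
  ring

theorem continuous_forwardValue (e : ℕ → ℝ) (lam r : ℝ) (t : ℕ) :
    Continuous fun J => forwardValue e lam r J t := by
  induction t with
  | zero => exact continuous_const
  | succ t ih => simp only [forwardValue]; fun_prop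

/-- Keeping only the transmit branch of the maximum leaves a linear recursion, which the weights
(1-r)^t telescope. -/
theorem sum_le_pow_mul_forwardValue {e : ℕ → ℝ} {lam r J : ℝ} (hr1 : r < 1) (T : ℕ) :
    ∑ t ∈ Finset.range T, (1 - r) ^ t * (J - e t - lam)
      ≤ (1 - r) ^ T * forwardValue e lam r J T := by
  have hq : 0 < 1 - r := by linarith
  induction T with
  | zero => simp [forwardValue]
  | succ T ih =>
    rw [Finset.sum_range_succ, forwardValue]
    have h1 : forwardValue e lam r J T + J - e T - lam
        ≤ (1 - r) * max (forwardValue e lam r J T + J - e T)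
          ((forwardValue e lam r J T + J - e T - lam) / (1 - r)) := by
      rw [← div_le_iff₀' hq]
      exact le_max_right _ _
    have h2 := mul_le_mul_of_nonneg_left h1 (pow_pos hq T).le
    rw [pow_succ, mul_assoc]
    linarith

/-- A pair `(J, V)` solving the Bellman equation, with bounded subsolutions for every smaller
constant. -/
def BellmanSolvable (e : ℕ → ℝ) (lam r J : ℝ) : Prop :=
  (∃ V : ℕ → ℝ, BddBelow (Set.range V) ∧
      ∀ τ, V τ = e τ - J + contValue lam r (V 0) (V (τ + 1))) ∧
    ∀ J' < J, ∃ u : ℕ → ℝ, (∃ B, ∀ τ, |u τ| ≤ B) ∧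
      ∀ τ, u τ ≤ e τ - J' + contValue lam r (u 0) (u (τ + 1))

theorem exists_abs_le_comp_min (g : ℕ → ℝ) (N : ℕ) : ∃ B, ∀ τ, |g (min τ N)| ≤ B :=
  ⟨∑ i ∈ Finset.range (N + 1), |g i|, fun τ =>
    Finset.single_le_sum (f := fun i => |g i|) (fun _ _ => abs_nonneg _)
      (Finset.mem_range.2 (Nat.lt_succ_of_le (min_le_right τ N)))⟩

theorem exists_bellmanSolvable_of_lt_one {e : ℕ → ℝ} {lam r : ℝ} (he : Monotone e)
    (he0 : 0 ≤ e 0) (hlam : 0 ≤ lam) (hr0 : 0 ≤ r) (hr1 : r < 1)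
    (hgrow : ∃ J : ℝ, ∀ T, ∑ t ∈ Finset.range T, (1 - r) ^ t * (e t + lam)
      ≤ J * ∑ t ∈ Finset.range T, (1 - r) ^ t) :
    ∃ J, 0 ≤ J ∧ BellmanSolvable e lam r J := by
  have hq : 0 < 1 - r := by linarith
  -- The optimal J is the least element of `G`. Nonemptiness comes from always transmitting, whose
  -- cost is bounded by `hgrow`.
  set G : Set ℝ := {J | ∀ t, 0 ≤ forwardValue e lam r J t} with hG
  have hclosed : IsClosed G := by
    rw [hG, Set.ofPred_forall]
    exact isClosed_iInter fun t => isClosed_le continuous_const (continuous_forwardValue e lam r t)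
  have hne : G.Nonempty := by
    obtain ⟨J, hJ⟩ := hgrow
    refine ⟨J, fun T => ?_⟩
    have h1 := sum_le_pow_mul_forwardValue (e := e) (lam := lam) (J := J) hr1 T
    have h2 : ∑ t ∈ Finset.range T, (1 - r) ^ t * (J - e t - lam)
        = J * ∑ t ∈ Finset.range T, (1 - r) ^ t
          - ∑ t ∈ Finset.range T, (1 - r) ^ t * (e t + lam) := by
      rw [Finset.mul_sum, ← Finset.sum_sub_distrib]
      exact Finset.sum_congr rfl fun t _ => by ring
    have h3 := hJ T
    have h4 : 0 ≤ (1 - r) ^ T * forwardValue e lam r J T := by linarith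
    exact nonneg_of_mul_nonneg_right h4 (pow_pos hq T)
  have hlow : ∀ J ∈ G, 0 ≤ J := by
    intro J hJ
    have h1 := hJ 1
    simp only [forwardValue, le_max_iff] at h1
    rcases h1 with h1 | h1
    · linarith
    · rw [le_div_iff₀ hq] at h1
      linarith
  have hmem : sInf G ∈ G := hclosed.csInf_mem hne ⟨0, hlow⟩
  refine ⟨sInf G, hlow _ hmem, ⟨forwardValue e lam r (sInf G), ⟨0, ?_⟩, fun τ =>
    forwardValue_bellman hr1 τ⟩, fun J' hJ' => ?_⟩
  · rintro _ ⟨t, rfl⟩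
    exact hmem t
  · have hnot : ¬ ∀ t, 0 ≤ forwardValue e lam r J' t := notMem_of_lt_csInf hJ' ⟨0, hlow⟩
    push Not at hnot
    classical
    obtain ⟨N, hN, hmin⟩ : ∃ N, forwardValue e lam r J' N < 0 ∧
        ∀ t < N, 0 ≤ forwardValue e lam r J' t :=
      ⟨Nat.find hnot, Nat.find_spec hnot, fun t ht => not_lt.1 (Nat.find_min hnot ht)⟩
    -- Freezing the forward solution at its first negative value keeps it bounded. Past N the
    -- inequality reduces to J' ≤ e τ, which holds because the step from N - 1 to N was a descent.
    refine ⟨fun τ => forwardValue e lam r J' (min τ N), exists_abs_le_comp_min _ N, fun τ => ?_⟩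
    have h0 : forwardValue e lam r J' (min 0 N) = 0 := by simp [forwardValue]
    simp only [h0]
    rcases lt_or_ge τ N with h | h
    · rw [min_eq_left h.le, min_eq_left (Nat.succ_le_of_lt h)]
      exact (forwardValue_bellman hr1 τ).le
    · rw [min_eq_right h, min_eq_right (h.trans (Nat.le_succ τ))]
      obtain ⟨M, rfl⟩ : ∃ M, N = M + 1 := by
        cases N with
        | zero => simp [forwardValue] at hN
        | succ M => exact ⟨M, rfl⟩
      have h1 := hmin M (Nat.lt_succ_self M)
      have h2 : forwardValue e lam r J' M + J' - e M ≤ forwardValue e lam r J' (M + 1) := by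
        conv_rhs => rw [forwardValue]
        exact le_max_left _ _
      have h3 := he ((Nat.le_succ M).trans h)
      have h4 : contValue lam r 0 (forwardValue e lam r J' (M + 1))
          = forwardValue e lam r J' (M + 1) := by
        refine min_eq_left ?_
        nlinarith
      rw [h4]
      linarith

/-- With a perfect channel every transmission restarts the process. Transmitting at state s gives
cycles of length s + 1 and cost rate `c s`; the function `u` is the value of staying silent. -/
theorem exists_bellmanSolvable_one {e : ℕ → ℝ} {lam : ℝ} (he : Monotone e)
    (he0 : 0 ≤ e 0) (hlam : 0 ≤ lam) : ∃ J, 0 ≤ J ∧ BellmanSolvable e lam 1 J := by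
  have hpos : ∀ t, 0 ≤ e t := fun t => he0.trans (he (Nat.zero_le t))
  have hcont : ∀ v y, contValue lam 1 v y = min y (lam + v) := fun v y => by simp [contValue]
  set c : ℕ → ℝ := fun s => (∑ t ∈ Finset.range (s + 1), e t + lam) / (s + 1 : ℕ) with hc
  have hc0 : ∀ s, 0 ≤ c s := fun s =>
    div_nonneg (add_nonneg (Finset.sum_nonneg fun t _ => hpos t) hlam) (Nat.cast_nonneg _)
  have hbdd : BddBelow (Set.range c) := ⟨0, by rintro _ ⟨s, rfl⟩; exact hc0 s⟩
  set J : ℝ := ⨅ s, c s with hJ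
  have hJ0 : 0 ≤ J := le_ciInf hc0
  set u : ℕ → ℝ := fun τ => ∑ t ∈ Finset.range τ, (J - e t) with hu
  have hu0 : u 0 = 0 := by simp [hu]
  have hus : ∀ τ, u (τ + 1) = u τ + (J - e τ) := fun τ => Finset.sum_range_succ _ _
  have hucast : ∀ τ : ℕ, u τ = τ * J - ∑ t ∈ Finset.range τ, e t := fun τ => by
    simp [hu, Finset.sum_sub_distrib]
  have hcle : ∀ s (x : ℝ), x ≤ c s ↔ (s + 1 : ℕ) * x ≤ ∑ t ∈ Finset.range (s + 1), e t + lam :=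
    fun s x => by rw [hc, le_div_iff₀' (by positivity)]
  have hule : ∀ s, u (s + 1) ≤ lam := fun s => by
    have := (hcle s J).1 (ciInf_le hbdd s)
    rw [hucast]
    linarith
  have hule' : ∀ s, u s ≤ lam := fun s => by
    cases s with
    | zero => rwa [hu0]
    | succ s => exact hule s
  have hsolve : ∀ V : ℕ → ℝ, BddBelow (Set.range V) → V 0 = 0 →
      (∀ τ, V τ = e τ - J + min (V (τ + 1)) lam) →
      ∃ V : ℕ → ℝ, BddBelow (Set.range V) ∧
        ∀ τ, V τ = e τ - J + contValue lam 1 (V 0) (V (τ + 1)) :=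
    fun V h1 h2 h3 => ⟨V, h1, fun τ => by rw [hcont, h2, add_zero]; exact h3 τ⟩
  refine ⟨J, hJ0, ?_, fun J' hJ' => ?_⟩
  · by_cases hatt : ∃ s, c s = J
    · obtain ⟨θ, hθ⟩ := hatt
      have huθ : u (θ + 1) = lam := by
        have h1 := (hcle θ (c θ)).1 le_rfl
        have h2 : ∑ t ∈ Finset.range (θ + 1), e t + lam = (θ + 1 : ℕ) * c θ := by
          rw [hc, mul_div_cancel₀]; positivity
        rw [hucast, ← hθ, ← h2]
        ring
      have heJ : ∀ τ, θ < τ → J ≤ e τ := fun τ hτ => by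
        have h1 := hule (θ + 1)
        rw [hus, huθ] at h1
        have h2 := he (Nat.succ_le_of_lt hτ)
        simp only [Nat.succ_eq_add_one] at h2
        linarith
      have hafter : ∀ τ, θ < τ → lam ≤ e τ - J + lam := fun τ hτ => by
        linarith [heJ τ hτ]
      -- Silence up to θ - 1, transmission from θ on; at θ itself both actions tie, as `u (θ + 1) =
      -- lam`.
      refine hsolve (fun τ => if τ ≤ θ then u τ else e τ - J + lam) ?_ (by simp [hu0]) fun τ => ?_
      · obtain ⟨B, hB⟩ := exists_abs_le_comp_min u θ
        refine ⟨min (-B) lam, ?_⟩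
        rintro _ ⟨τ, rfl⟩
        dsimp only
        split_ifs with h
        · have h1 := hB τ
          rw [min_eq_left h] at h1
          exact (min_le_left _ _).trans (abs_le.1 h1).1
        · exact (min_le_right _ _).trans (hafter τ (not_le.1 h))
      · rcases lt_trichotomy τ θ with h | h | h
        · rw [if_pos h.le, if_pos (Nat.succ_le_of_lt h), min_eq_left (hule τ), hus]
          ring
        · subst h
          rw [if_pos le_rfl, if_neg (by omega), min_eq_right (hafter _ (by omega))]
          linarith [hus τ]
        · rw [if_neg (by omega), if_neg (by omega), min_eq_right (hafter _ (by omega))]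
    · push Not at hatt
      -- If e ever exceeded J, the rates `c s` would stay above J + ε for large s, so the infimum
      -- would be attained. Hence silence forever is optimal and `u` itself is a solution.
      have heJ : ∀ τ, e τ ≤ J := by
        by_contra! hex
        obtain ⟨T, hT⟩ := hex
        set ε := (e T - J) / 2 with hε
        have hεpos : 0 < ε := by rw [hε]; linarith
        have htail : ∀ k : ℕ, u (T + k) ≤ lam - k * (2 * ε) := by
          intro k
          induction k with
          | zero => simpa using hule' T
          | succ k ih =>
            rw [← add_assoc, hus]
            have := he (Nat.le_add_right T k)
            push_cast
            linarith
        -- Each step past T loses at least 2ε; from 2T on these are at least half of all steps, so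
        -- the average loss is at least ε.
        have hlarge : ∀ s, 2 * T ≤ s → J + ε ≤ c s := by
          intro s hs
          rw [hcle]
          obtain ⟨k, rfl⟩ := Nat.exists_eq_add_of_le hs
          have h1 := htail (T + k + 1)
          have h2 := hucast (2 * T + k + 1)
          rw [show T + (T + k + 1) = 2 * T + k + 1 by ring] at h1
          push_cast at h1 h2 ⊢
          have h3 : 0 ≤ ((k : ℝ) + 1) * ε := by positivity
          linarith
        obtain ⟨s₀, -, hs₀⟩ := Finset.exists_min_image (Finset.range (2 * T + 1)) c ⟨0, by simp⟩
        have hlt : J < c s₀ := lt_of_le_of_ne (ciInf_le hbdd s₀) (Ne.symm (hatt s₀))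
        have : min (c s₀) (J + ε) ≤ J := by
          refine le_ciInf fun s => ?_
          rcases lt_or_ge s (2 * T) with h | h
          · exact (min_le_left _ _).trans (hs₀ s (Finset.mem_range.2 (by omega)))
          · exact (min_le_right _ _).trans (hlarge s h)
        rcases min_le_iff.1 this with h | h <;> linarith
      refine hsolve u ⟨0, ?_⟩ hu0 fun τ => ?_
      · rintro _ ⟨τ, rfl⟩
        exact Finset.sum_nonneg fun t _ => sub_nonneg.2 (heJ t)
      · rw [min_eq_left (hule τ), hus]
        ring
  · by_cases hex : ∃ N, J ≤ e N
    · obtain ⟨N, hN⟩ := hex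
      refine ⟨fun τ => u (min τ N), exists_abs_le_comp_min u N, fun τ => ?_⟩
      simp only [hcont, Nat.zero_min, hu0, add_zero]
      rw [min_eq_left (hule' _)]
      rcases lt_or_ge τ N with h | h
      · rw [min_eq_left h.le, min_eq_left (Nat.succ_le_of_lt h), hus]
        linarith
      · rw [min_eq_right h, min_eq_right (h.trans (Nat.le_succ τ))]
        linarith [he h]
    · push Not at hex
      refine ⟨u, ⟨lam, fun τ => ?_⟩, fun τ => ?_⟩
      · rw [abs_of_nonneg (Finset.sum_nonneg fun t _ => sub_nonneg.2 (hex t).le)]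
        exact hule' τ
      · rw [hcont, hu0, add_zero, min_eq_left (hule τ), hus]
        linarith

/-! ### Expectations along the decision process -/

theorem tsum_bind_mul {α β : Type*} (p : PMF α) (f : α → PMF β) (F : β → ℝ≥0∞) :
    ∑' b, p.bind f b * F b = ∑' a, p a * ∑' b, f a b * F b := by
  simp_rw [PMF.bind_apply, ← ENNReal.tsum_mul_right, ← ENNReal.tsum_mul_left]
  rw [ENNReal.tsum_comm]
  simp_rw [mul_assoc]

theorem tsum_pure_mul {α : Type*} (a : α) (F : α → ℝ≥0∞) :
    ∑' b, PMF.pure a b * F b = F a := by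
  rw [tsum_eq_single a fun b hb => by rw [PMF.pure_apply_of_ne _ _ hb, zero_mul]]
  rw [PMF.pure_apply_self, one_mul]

theorem tsum_map_mul {α β : Type*} (p : PMF α) (f : α → β) (F : β → ℝ≥0∞) :
    ∑' b, p.map f b * F b = ∑' a, p a * F (f a) := by
  rw [← PMF.bind_pure_comp, tsum_bind_mul]
  simp_rw [Function.comp_apply, tsum_pure_mul]

/-- The expected value of `w` at the next state. -/
noncomputable def nextMean (r : unitInterval) (w : ℕ → ℝ≥0∞) (τ : ℕ) (a : Bool) : ℝ≥0∞ :=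
  if a then ENNReal.ofReal r * w 0 + ENNReal.ofReal (1 - r) * w (τ + 1) else w (τ + 1)

theorem tsum_transLaw_mul (r : unitInterval) (w : ℕ → ℝ≥0∞) (τ : ℕ) (a : Bool) :
    ∑' s, transLaw r τ a s * w s = nextMean r w τ a := by
  have hval : ∀ s, transLaw r τ a s = ENNReal.ofReal (transProb r τ a s) := fun _ => rfl
  rw [tsum_eq_sum (s := ({0, τ + 1} : Finset ℕ))]
  · rw [Finset.sum_pair (Nat.succ_ne_zero τ).symm]
    cases a <;> simp [hval, transProb, nextMean]
  · intro s hs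
    simp only [Finset.mem_insert, Finset.mem_singleton, not_or] at hs
    simp [hval, transProb, hs.1, hs.2]

/-- The expectation of `G (τ(k)) (a(k))` under `f`. -/
noncomputable def meanAt (r : unitInterval) (f : Policy) (G : ℕ → Bool → ℝ≥0∞) (k : ℕ) : ℝ≥0∞ :=
  ∑' h : History k, historyLaw r f k h * G (h.1 (Fin.last k)) (f k h)

theorem expectAt_eq_meanAt (r : unitInterval) (f : Policy) (g : ℕ → Bool → ℝ) :
    expectAt r f g = meanAt r f fun τ a => ENNReal.ofReal (g τ a) := rfl

theorem meanAt_zero (r : unitInterval) (f : Policy) (w : ℕ → ℝ≥0∞) :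
    meanAt r f (fun τ _ => w τ) 0 = w 0 := by
  rw [meanAt, historyLaw, tsum_pure_mul _ fun h : History 0 => w (h.1 (Fin.last 0))]

/-- Conditioning on the history: the next state depends on it only through the current state and
action. -/
theorem meanAt_succ (r : unitInterval) (f : Policy) (w : ℕ → ℝ≥0∞) (k : ℕ) :
    meanAt r f (fun τ _ => w τ) (k + 1) = meanAt r f (nextMean r w) k := by
  rw [meanAt, historyLaw, tsum_bind_mul _ _ fun h : History (k + 1) => w (h.1 (Fin.last (k + 1)))]
  simp_rw [tsum_map_mul, Fin.snoc_last, tsum_transLaw_mul]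
  rfl

theorem meanAt_add (r : unitInterval) (f : Policy) (G H : ℕ → Bool → ℝ≥0∞) (k : ℕ) :
    meanAt r f (fun τ a => G τ a + H τ a) k = meanAt r f G k + meanAt r f H k := by
  simp_rw [meanAt, mul_add]
  exact ENNReal.tsum_add

theorem meanAt_const_mul (r : unitInterval) (f : Policy) (c : ℝ≥0∞) (G : ℕ → Bool → ℝ≥0∞)
    (k : ℕ) : meanAt r f (fun τ a => c * G τ a) k = c * meanAt r f G k := by
  simp_rw [meanAt, ← ENNReal.tsum_mul_left]
  exact tsum_congr fun h => by ring

theorem meanAt_const (r : unitInterval) (f : Policy) (c : ℝ≥0∞) (k : ℕ) :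
    meanAt r f (fun _ _ => c) k = c := by
  rw [meanAt, ENNReal.tsum_mul_right, PMF.tsum_coe, one_mul]

theorem meanAt_mono {r : unitInterval} {f : Policy} {G H : ℕ → Bool → ℝ≥0∞} {k : ℕ}
    (h : ∀ x : History k, G (x.1 (Fin.last k)) (f k x) ≤ H (x.1 (Fin.last k)) (f k x)) :
    meanAt r f G k ≤ meanAt r f H k :=
  ENNReal.tsum_le_tsum fun x => mul_le_mul_right (h x) _

/-- A supersolution of the evaluation equation bounds the accumulated cost from above. -/
theorem sum_meanAt_le {r : unitInterval} {f : Policy} {G : ℕ → Bool → ℝ≥0∞} {w : ℕ → ℝ≥0∞}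
    {c : ℝ≥0∞} (h : ∀ k (x : History k), G (x.1 (Fin.last k)) (f k x)
      + nextMean r w (x.1 (Fin.last k)) (f k x) ≤ w (x.1 (Fin.last k)) + c) (T : ℕ) :
    ∑ k ∈ Finset.range T, meanAt r f G k + meanAt r f (fun τ _ => w τ) T ≤ w 0 + T * c := by
  induction T with
  | zero => simp [meanAt_zero]
  | succ T ih =>
    have h1 : meanAt r f G T + meanAt r f (nextMean r w) T
        ≤ meanAt r f (fun τ _ => w τ) T + c := by
      rw [← meanAt_add, ← meanAt_const r f c T, ← meanAt_add]
      exact meanAt_mono (h T)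
    rw [Finset.sum_range_succ, meanAt_succ, add_assoc]
    refine (add_le_add_right h1 _).trans ?_
    rw [← add_assoc]
    refine (add_le_add_left ih _).trans (le_of_eq ?_)
    push_cast
    ring

/-- A subsolution of the evaluation equation bounds the accumulated cost from below. -/
theorem le_sum_meanAt {r : unitInterval} {f : Policy} {G : ℕ → Bool → ℝ≥0∞} {w : ℕ → ℝ≥0∞}
    {c : ℝ≥0∞} (h : ∀ k (x : History k), w (x.1 (Fin.last k)) + c ≤ G (x.1 (Fin.last k)) (f k x)
      + nextMean r w (x.1 (Fin.last k)) (f k x)) (T : ℕ) :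
    w 0 + T * c ≤ ∑ k ∈ Finset.range T, meanAt r f G k + meanAt r f (fun τ _ => w τ) T := by
  induction T with
  | zero => simp [meanAt_zero]
  | succ T ih =>
    have h1 : meanAt r f (fun τ _ => w τ) T + c
        ≤ meanAt r f G T + meanAt r f (nextMean r w) T := by
      rw [← meanAt_add, ← meanAt_const r f c T, ← meanAt_add]
      exact meanAt_mono (h T)
    rw [Finset.sum_range_succ, meanAt_succ, add_assoc]
    refine le_trans ?_ (add_le_add_right h1 _)
    rw [← add_assoc]
    refine le_trans (le_of_eq ?_) (add_le_add_left ih _)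
    push_cast
    ring

theorem meanAt_state_le {r : unitInterval} {f : Policy} {w : ℕ → ℝ≥0∞} {B : ℝ≥0∞}
    (h : ∀ τ, w τ ≤ B) (k : ℕ) : meanAt r f (fun τ _ => w τ) k ≤ B := by
  rw [← meanAt_const r f B k]
  exact meanAt_mono fun x => h _

/-! ### Long-run averages -/

theorem tendsto_const_div_natCast {B : ℝ≥0∞} (hB : B ≠ ⊤) :
    Tendsto (fun T : ℕ => B / (T : ℝ≥0∞)) atTop (𝓝 0) := by
  simpa using ENNReal.Tendsto.const_div ENNReal.tendsto_nat_nhds_top (Or.inr hB)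

theorem le_average_add {c B x : ℝ≥0∞} {T : ℕ} (hT : T ≠ 0) (h : T * c ≤ x + B) :
    c ≤ x / T + B / T := by
  rw [← ENNReal.add_div, ENNReal.le_div_iff_mul_le (by simp [hT]) (by simp), mul_comm]
  exact h

theorem average_le_add {c B x : ℝ≥0∞} {T : ℕ} (hT : T ≠ 0) (h : x ≤ B + T * c) :
    x / T ≤ c + B / T := by
  have hT' : (T : ℝ≥0∞) ≠ 0 := by simp [hT]
  rw [ENNReal.div_le_iff hT' (by simp), add_mul, ENNReal.div_mul_cancel hT' (by simp)]
  rwa [add_comm, mul_comm c]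

theorem le_limsup_average {x : ℕ → ℝ≥0∞} {c B : ℝ≥0∞} (hB : B ≠ ⊤)
    (h : ∀ T : ℕ, T * c ≤ x T + B) : c ≤ limsup (fun T : ℕ => x T / (T : ℝ≥0∞)) atTop := by
  rw [← ENNReal.limsup_add_of_right_tendsto_zero (tendsto_const_div_natCast hB)]
  refine le_limsup_of_frequently_le (Eventually.frequently ?_)
  filter_upwards [eventually_ne_atTop 0] with T hT using le_average_add hT (h T)

theorem limsup_average_le {x : ℕ → ℝ≥0∞} {c B : ℝ≥0∞} (hB : B ≠ ⊤)
    (h : ∀ T : ℕ, x T ≤ B + T * c) : limsup (fun T : ℕ => x T / (T : ℝ≥0∞)) atTop ≤ c := by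
  have h1 : limsup (fun T : ℕ => c + B / (T : ℝ≥0∞)) atTop = c := by
    have := (tendsto_const_div_natCast hB).const_add c
    rw [add_zero] at this
    exact this.limsup_eq
  rw [← h1]
  refine limsup_le_limsup ?_
  filter_upwards [eventually_ne_atTop 0] with T hT using average_le_add hT (h T)

theorem limsup_average_add_le {x y : ℕ → ℝ≥0∞} :
    limsup (fun T : ℕ => (x T + y T) / (T : ℝ≥0∞)) atTop
      ≤ limsup (fun T : ℕ => x T / (T : ℝ≥0∞)) atTop
        + limsup (fun T : ℕ => y T / (T : ℝ≥0∞)) atTop := by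
  simp_rw [ENNReal.add_div]
  refine ENNReal.le_of_forall_pos_le_add fun ε hε hlt => ?_
  have hε2 : (ε / 2 : ℝ≥0∞) ≠ 0 := by simpa using hε.ne'
  rw [ENNReal.add_lt_top] at hlt
  have h1 := eventually_lt_of_limsup_lt (ENNReal.lt_add_right hlt.1.ne hε2)
  have h2 := eventually_lt_of_limsup_lt (ENNReal.lt_add_right hlt.2.ne hε2)
  refine limsup_le_of_le (by isBoundedDefault) ?_
  filter_upwards [h1, h2] with T hT1 hT2
  refine (add_le_add hT1.le hT2.le).trans (le_of_eq ?_)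
  rw [add_add_add_comm, ENNReal.add_halves]

/-! ### Costs of policies -/

theorem nextMean_ofReal (r : unitInterval) {w : ℕ → ℝ} (hw : ∀ s, 0 ≤ w s) (τ : ℕ) (a : Bool) :
    nextMean r (fun s => ENNReal.ofReal (w s)) τ a
      = ENNReal.ofReal (if a then r * w 0 + (1 - r) * w (τ + 1) else w (τ + 1)) := by
  have h1 : (0 : ℝ) ≤ r := r.2.1
  have h2 : (0 : ℝ) ≤ 1 - r := sub_nonneg.2 r.2.2
  cases a
  · simp [nextMean]
  · simp only [nextMean, if_true]
    rw [ENNReal.ofReal_add (mul_nonneg h1 (hw _)) (mul_nonneg h2 (hw _)), ENNReal.ofReal_mul h1,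
      ENNReal.ofReal_mul h2]

theorem actionValue_nonneg (a : Bool) : 0 ≤ actionValue a := by
  cases a <;> simp [actionValue]

section

variable {e : ℕ → ℝ} {lam : ℝ} {r : unitInterval}

/-- A bounded subsolution of the Bellman equation bounds the average cost of every policy. -/
theorem ofReal_le_longRunAverage {J B : ℝ} {u : ℕ → ℝ}
    (hB : ∀ τ, |u τ| ≤ B)
    (hu : ∀ τ, u τ ≤ e τ - J + contValue lam r (u 0) (u (τ + 1))) (f : Policy) :
    ENNReal.ofReal J ≤ longRunAverage r f fun τ a => e τ + lam * actionValue a := by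
  rcases le_total J 0 with hJ | hJ
  · simp [ENNReal.ofReal_of_nonpos hJ]
  -- Adding a constant preserves the subsolution inequality, as transition probabilities sum to 1,
  -- and makes the telescoping possible in `ℝ≥0∞`. The terminal term is then at most 2B.
  have hw : ∀ s, 0 ≤ u s + B := fun s => by linarith [(abs_le.1 (hB s)).1]
  refine le_limsup_average (B := ENNReal.ofReal (2 * B)) ENNReal.ofReal_ne_top fun T => ?_
  have h1 := le_sum_meanAt (r := r) (f := f) (c := ENNReal.ofReal J)
    (G := fun τ a => ENNReal.ofReal (e τ + lam * actionValue a))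
    (w := fun s => ENNReal.ofReal (u s + B)) (fun k x => ?_) T
  · have h2 := meanAt_state_le (r := r) (f := f) (w := fun s => ENNReal.ofReal (u s + B))
      (B := ENNReal.ofReal (2 * B))
      (fun τ => ENNReal.ofReal_le_ofReal (by linarith [(abs_le.1 (hB τ)).2])) T
    exact (le_add_self.trans h1).trans (add_le_add_right h2 _)
  · generalize x.1 (Fin.last k) = τ
    generalize f k x = a
    have h1 := hu τ
    rw [nextMean_ofReal r hw, ← ENNReal.ofReal_add (hw τ) hJ]
    refine (ENNReal.ofReal_le_ofReal ?_).trans ENNReal.ofReal_add_le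
    unfold contValue at h1
    cases a
    · have := min_le_left (u (τ + 1)) (lam + r * u 0 + (1 - r) * u (τ + 1))
      simp [actionValue]
      linarith
    · have := min_le_right (u (τ + 1)) (lam + r * u 0 + (1 - r) * u (τ + 1))
      simp [actionValue]
      linarith

/-- Following a minimizing decision rule, the accumulated cost exceeds `T * J` by at most a
constant. -/
theorem exists_sum_expectAt_le (he : ∀ τ, 0 ≤ e τ) (hlam : 0 ≤ lam) {J : ℝ} (hJ : 0 ≤ J)
    {V : ℕ → ℝ} (hbdd : BddBelow (Set.range V)) {d : ℕ → Bool}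
    (hV : ∀ τ, V τ = e τ + lam * actionValue (d τ)
      + (if d τ then r * V 0 + (1 - r) * V (τ + 1) else V (τ + 1)) - J) :
    ∃ B : ℝ≥0∞, B ≠ ⊤ ∧ ∀ T : ℕ,
      ∑ k ∈ Finset.range T, expectAt r (stationary d) (fun τ a => e τ + lam * actionValue a) k
        ≤ B + T * ENNReal.ofReal J := by
  obtain ⟨b, hb⟩ := hbdd
  have hw : ∀ s, 0 ≤ V s - b := fun s => sub_nonneg.2 (hb ⟨s, rfl⟩)
  refine ⟨ENNReal.ofReal (V 0 - b), ENNReal.ofReal_ne_top, fun T => ?_⟩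
  have h1 := sum_meanAt_le (r := r) (f := stationary d) (c := ENNReal.ofReal J)
    (G := fun τ a => ENNReal.ofReal (e τ + lam * actionValue a))
    (w := fun s => ENNReal.ofReal (V s - b)) (fun k x => ?_) T
  · exact le_self_add.trans h1
  · unfold stationary
    generalize x.1 (Fin.last k) = τ
    have h1 := hV τ
    have hc : 0 ≤ e τ + lam * actionValue (d τ) :=
      add_nonneg (he τ) (mul_nonneg hlam (actionValue_nonneg _))
    have h2 : (0 : ℝ) ≤ r := r.2.1
    have h3 : (0 : ℝ) ≤ 1 - r := sub_nonneg.2 r.2.2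
    rw [nextMean_ofReal r hw, ← ENNReal.ofReal_add (hw τ) hJ, ← ENNReal.ofReal_add hc]
    · refine ENNReal.ofReal_le_ofReal ?_
      split_ifs at h1 ⊢ <;> linarith
    · split_ifs
      · exact add_nonneg (mul_nonneg h2 (hw _)) (mul_nonneg h3 (hw _))
      · exact hw _

/-- Under a threshold rule the expected number of transmissions grows linearly. -/
theorem exists_le_sum_expectAt_thresholdRule (θ : ℕ∞) :
    ∃ ρ B : ℝ≥0∞, B ≠ ⊤ ∧ ρ ≠ ⊤ ∧ (∀ T : ℕ, T * ρ ≤ ∑ k ∈ Finset.range T,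
        expectAt r (stationary (thresholdRule θ)) (fun _ a => actionValue a) k + B) ∧
      ∀ T : ℕ, ∑ k ∈ Finset.range T,
        expectAt r (stationary (thresholdRule θ)) (fun _ a => actionValue a) k ≤ T * ρ := by
  induction θ with
  | top =>
    refine ⟨0, 0, by simp, by simp, by simp, fun T => ?_⟩
    rw [mul_zero, nonpos_iff_eq_zero]
    refine Finset.sum_eq_zero fun k _ => ?_
    simp [expectAt, stationary, thresholdRule, actionValue]
  | coe θ =>
    have hr0 : (0 : ℝ) ≤ r := r.2.1
    -- For r > 0 a cycle has θ silent steps and on average 1/r attempts, so the rate is (1/r) / (θ +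
    -- 1/r).
    set ρ : ℝ := 1 / (1 + r * θ) with hρ
    have hpos : (0 : ℝ) < 1 + r * θ := by positivity
    have hρ0 : 0 ≤ ρ := by positivity
    have hρ1 : ρ * (1 + r * θ) = 1 := by rw [hρ]; field_simp
    have hw : ∀ s : ℕ, 0 ≤ (min s θ : ℕ) * ρ := fun s => by positivity
    -- The bounded function `min s θ * ρ` solves the Poisson equation with equality, so it serves
    -- both bounds.
    have hpoisson : ∀ k (x : History k),
        ENNReal.ofReal (actionValue (stationary (thresholdRule θ) k x))
          + nextMean r (fun s => ENNReal.ofReal ((min s θ : ℕ) * ρ)) (x.1 (Fin.last k))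
            (stationary (thresholdRule θ) k x)
          = ENNReal.ofReal ((min (x.1 (Fin.last k)) θ : ℕ) * ρ) + ENNReal.ofReal ρ := by
      intro k x
      unfold stationary
      generalize x.1 (Fin.last k) = τ
      rw [nextMean_ofReal r hw, ← ENNReal.ofReal_add (hw τ) hρ0,
        ← ENNReal.ofReal_add (actionValue_nonneg _)]
      · congr 1
        by_cases h : θ ≤ τ
        · have h1 : thresholdRule θ τ = true := by simpa [thresholdRule] using h
          simp only [h1, actionValue, if_true, min_eq_right h, min_eq_right (h.trans (Nat.le_succ τ)),
            Nat.zero_min, Nat.cast_zero]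
          linarith
        · have h1 : thresholdRule θ τ = false := by simpa [thresholdRule] using h
          rw [not_le] at h
          simp only [h1, actionValue, min_eq_left h.le, min_eq_left (Nat.succ_le_of_lt h)]
          push_cast
          simp
          ring
      · have h3 : (0 : ℝ) ≤ 1 - r := sub_nonneg.2 r.2.2
        split_ifs
        · exact add_nonneg (mul_nonneg hr0 (hw _)) (mul_nonneg h3 (hw _))
        · exact hw _
    refine ⟨ENNReal.ofReal ρ, ENNReal.ofReal (θ * ρ), ENNReal.ofReal_ne_top,
      ENNReal.ofReal_ne_top, fun T => ?_, fun T => ?_⟩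
    · have h1 := le_sum_meanAt (r := r) (f := stationary (thresholdRule θ))
        (c := ENNReal.ofReal ρ) (G := fun _ a => ENNReal.ofReal (actionValue a))
        (w := fun s => ENNReal.ofReal ((min s θ : ℕ) * ρ)) (fun k x => (hpoisson k x).ge) T
      refine (le_add_self.trans h1).trans (add_le_add_right (meanAt_state_le (fun τ => ?_) T) _)
      refine ENNReal.ofReal_le_ofReal (mul_le_mul_of_nonneg_right ?_ hρ0)
      exact_mod_cast min_le_right τ θ
    · have h1 := sum_meanAt_le (r := r) (f := stationary (thresholdRule θ))
        (c := ENNReal.ofReal ρ) (G := fun _ a => ENNReal.ofReal (actionValue a))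
        (w := fun s => ENNReal.ofReal ((min s θ : ℕ) * ρ)) (fun k x => (hpoisson k x).le) T
      have h2 := le_self_add.trans h1
      simp only [Nat.zero_min, Nat.cast_zero, zero_mul, ENNReal.ofReal_zero, zero_add] at h2
      exact h2

theorem expectAt_add_mul (he : ∀ τ, 0 ≤ e τ) (hlam : 0 ≤ lam) (f : Policy) (k : ℕ) :
    expectAt r f (fun τ a => e τ + lam * actionValue a) k
      = expectAt r f (fun τ _ => e τ) k
        + ENNReal.ofReal lam * expectAt r f (fun _ a => actionValue a) k := by
  simp only [expectAt_eq_meanAt]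
  rw [← meanAt_const_mul, ← meanAt_add]
  congr 1
  funext τ a
  rw [ENNReal.ofReal_add (he τ) (mul_nonneg hlam (actionValue_nonneg a)), ENNReal.ofReal_mul hlam]

theorem longRunAverage_add_mul_le (he : ∀ τ, 0 ≤ e τ) (hlam : 0 ≤ lam) (f : Policy) :
    longRunAverage r f (fun τ a => e τ + lam * actionValue a)
      ≤ longRunAverage r f (fun τ _ => e τ)
        + ENNReal.ofReal lam * longRunAverage r f fun _ a => actionValue a := by
  unfold longRunAverage
  rw [← ENNReal.limsup_const_mul_of_ne_top ENNReal.ofReal_ne_top]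
  simp_rw [expectAt_add_mul he hlam, Finset.sum_add_distrib, ← Finset.mul_sum, ← mul_div_assoc]
  exact limsup_average_add_le

/-- For a threshold rule, bounds on the accumulated cost pass to the sum of the averages. -/
theorem longRunAverage_thresholdRule_le (he : ∀ τ, 0 ≤ e τ) (hlam : 0 ≤ lam) (θ : ℕ∞)
    {B c : ℝ≥0∞} (hB : B ≠ ⊤)
    (h : ∀ T : ℕ, ∑ k ∈ Finset.range T, expectAt r (stationary (thresholdRule θ))
      (fun τ a => e τ + lam * actionValue a) k ≤ B + T * c) :
    longRunAverage r (stationary (thresholdRule θ)) (fun τ _ => e τ)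
      + ENNReal.ofReal lam * longRunAverage r (stationary (thresholdRule θ))
        (fun _ a => actionValue a) ≤ c := by
  obtain ⟨ρ, D, hD, hρ, hlow, hupp⟩ := exists_le_sum_expectAt_thresholdRule (r := r) θ
  have hcomm : longRunAverage r (stationary (thresholdRule θ)) (fun _ a => actionValue a) ≤ ρ :=
    limsup_average_le (B := 0) (by simp) fun T => by rw [zero_add]; exact hupp T
  set L := ENNReal.ofReal lam with hL
  have hL' : L ≠ ⊤ := ENNReal.ofReal_ne_top
  have hC : B + L * D ≠ ⊤ := ENNReal.add_ne_top.2 ⟨hB, ENNReal.mul_ne_top hL' hD⟩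
  have hsum : ∀ T : ℕ, ∑ k ∈ Finset.range T, expectAt r (stationary (thresholdRule θ))
      (fun τ _ => e τ) k + T * (L * ρ) ≤ (B + L * D) + T * c := by
    intro T
    have h1 := h T
    simp_rw [expectAt_add_mul he hlam, Finset.sum_add_distrib, ← Finset.mul_sum] at h1
    calc _ = ∑ k ∈ Finset.range T, expectAt r (stationary (thresholdRule θ)) (fun τ _ => e τ) k
            + L * (T * ρ) := by ring
      _ ≤ _ := add_le_add_right (mul_le_mul_right (hlow T) L) _
      _ = _ + L * D := by rw [mul_add, ← add_assoc]
      _ ≤ (B + T * c) + L * D := add_le_add_left h1 _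
      _ = _ := by ring
  -- Needed because subtraction in `ℝ≥0∞` truncates: only now does `c - L * ρ` add back to `c`.
  have hLρ : L * ρ ≤ c := by
    have h1 := tendsto_const_div_natCast hC
    have h2 := h1.const_add c
    rw [add_zero] at h2
    refine ge_of_tendsto h2 ?_
    filter_upwards [eventually_ne_atTop 0] with T hT
    have h3 := average_le_add hT (le_add_self.trans (hsum T))
    rwa [mul_comm, ENNReal.mul_div_cancel_right (by simp [hT]) (by simp)] at h3
  have herr : longRunAverage r (stationary (thresholdRule θ)) (fun τ _ => e τ) ≤ c - L * ρ := by
    refine limsup_average_le hC fun T => ?_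
    have hTρ : (T : ℝ≥0∞) * (L * ρ) ≠ ⊤ :=
      ENNReal.mul_ne_top (by simp) (ENNReal.mul_ne_top hL' hρ)
    rw [← ENNReal.add_le_add_iff_right hTρ, add_assoc, ← mul_add, tsub_add_cancel_of_le hLρ]
    exact hsum T
  calc _ ≤ (c - L * ρ) + L * ρ := add_le_add herr (mul_le_mul_right hcomm L)
    _ = c := tsub_add_cancel_of_le hLρ

end

/-! ### The error covariance -/

section

variable {n m : ℕ} {A W Pbar : Matrix (Fin n) (Fin n) ℝ}

theorem posSemidef_pow_mul_mul {D : Matrix (Fin n) (Fin n) ℝ} (hD : D.PosSemidef) (t : ℕ) :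
    (A ^ t * D * Aᵀ ^ t).PosSemidef := by
  have := hD.mul_mul_conjTranspose_same (A ^ t)
  rwa [Matrix.conjTranspose_eq_transpose_of_trivial, Matrix.transpose_pow] at this

theorem posSemidef_predictCov_sub {C : Matrix (Fin m) (Fin n) ℝ} {R : Matrix (Fin m) (Fin m) ℝ}
    (hW : W.PosSemidef) (hR : R.PosDef) (hP : IsKalmanSteadyState A C W R Pbar) :
    (predictCov A W Pbar - Pbar).PosSemidef := by
  obtain ⟨hP0, hfix⟩ := hP
  have hM : (predictCov A W Pbar).PosSemidef := by
    have := posSemidef_pow_mul_mul (A := A) hP0 1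
    rw [pow_one, pow_one] at this
    exact this.add hW
  set M := predictCov A W Pbar with hMdef
  have hMt : Mᵀ = M := by
    rw [← Matrix.conjTranspose_eq_transpose_of_trivial]; exact hM.isHermitian
  have hS : (C * M * Cᵀ + R).PosDef := by
    have := hM.mul_mul_conjTranspose_same C
    rw [Matrix.conjTranspose_eq_transpose_of_trivial] at this
    exact Matrix.PosDef.posSemidef_add this hR
  have h := hS.inv.posSemidef.mul_mul_conjTranspose_same (M * Cᵀ)
  rw [Matrix.conjTranspose_eq_transpose_of_trivial, Matrix.transpose_mul, hMt,
    Matrix.transpose_transpose, ← Matrix.mul_assoc] at h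
  have heq : M - Pbar = M * Cᵀ * (C * M * Cᵀ + R)⁻¹ * C * M := by
    conv_lhs => rw [hfix, correctCov]
    exact sub_sub_cancel _ _
  rwa [heq]

/-- Writing W = (M - Pbar) + Pbar - A Pbar Aᵀ, with M the predicted covariance, makes the sum
telescope. -/
theorem remoteCov_succ (τ : ℕ) :
    remoteCov A W Pbar (τ + 1)
      = remoteCov A W Pbar τ + A ^ τ * (predictCov A W Pbar - Pbar) * Aᵀ ^ τ := by
  simp only [remoteCov, predictCov, Finset.sum_range_succ, pow_succ A, pow_succ' Aᵀ]
  noncomm_ring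

theorem sum_trace_le_trace_remoteCov (hP : Pbar.PosSemidef) (τ : ℕ) :
    ∑ t ∈ Finset.range τ, (A ^ t * W * Aᵀ ^ t).trace ≤ (remoteCov A W Pbar τ).trace := by
  rw [remoteCov, Matrix.trace_add, Matrix.trace_sum]
  exact le_add_of_nonneg_left (posSemidef_pow_mul_mul hP τ).trace_nonneg

theorem trace_remoteCov_zero_nonneg (hP : Pbar.PosSemidef) :
    0 ≤ (remoteCov A W Pbar 0).trace := by
  simpa using sum_trace_le_trace_remoteCov (A := A) (W := W) hP 0

theorem monotone_trace_remoteCov (hD : (predictCov A W Pbar - Pbar).PosSemidef) :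
    Monotone fun τ => (remoteCov A W Pbar τ).trace :=
  monotone_nat_of_le_succ fun τ => by
    rw [remoteCov_succ, Matrix.trace_add]
    exact le_add_of_nonneg_right (posSemidef_pow_mul_mul hD τ).trace_nonneg

/-! ### Left eigenvectors and growth of matrix powers -/

theorem mem_spectrum_iff_exists_vecMul (B : Matrix (Fin n) (Fin n) ℂ) (μ : ℂ) :
    μ ∈ spectrum ℂ B ↔ ∃ v : Fin n → ℂ, v ≠ 0 ∧ v ᵥ* B = μ • v := by
  rw [spectrum.mem_iff, Matrix.isUnit_iff_isUnit_det, isUnit_iff_ne_zero, not_not,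
    ← Matrix.exists_vecMul_eq_zero_iff]
  refine exists_congr fun v => and_congr_right fun _ => ?_
  rw [Matrix.vecMul_sub, sub_eq_zero, Algebra.algebraMap_eq_smul_one, Matrix.vecMul_smul,
    Matrix.vecMul_one, eq_comm]

section Norm

open scoped Matrix.Norms.Operator

theorem norm_entry_le_opNorm (B : Matrix (Fin n) (Fin n) ℂ) (i j : Fin n) : ‖B i j‖ ≤ ‖B‖ := by
  have h : ‖B i j‖₊ ≤ ‖B‖₊ := by
    rw [Matrix.linfty_opNNNorm_def]
    exact (Finset.single_le_sum (f := fun j => ‖B i j‖₊) (fun _ _ => zero_le)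
      (Finset.mem_univ j)).trans
      (Finset.le_sup (f := fun i => ∑ j, ‖B i j‖₊) (Finset.mem_univ i))
  exact h

theorem exists_mem_spectrum_of_one_le {B : Matrix (Fin n) (Fin n) ℂ}
    (h : 1 ≤ spectralRadius ℂ B) : ∃ μ ∈ spectrum ℂ B, 1 ≤ ‖μ‖ := by
  have hne : (spectrum ℂ B).Nonempty := by
    rw [Set.nonempty_iff_ne_empty]
    intro h0
    simp [spectralRadius, h0] at h
  obtain ⟨μ, hμ, hμ'⟩ := spectrum.exists_nnnorm_eq_spectralRadius_of_nonempty hne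
  rw [← hμ'] at h
  exact ⟨μ, hμ, by exact_mod_cast h⟩

theorem norm_lt_one_of_mem_spectrum {B : Matrix (Fin n) (Fin n) ℂ}
    (h : spectralRadius ℂ B < 1) {μ : ℂ} (hμ : μ ∈ spectrum ℂ B) : ‖μ‖ < 1 := by
  have : (‖μ‖₊ : ℝ≥0∞) ≤ spectralRadius ℂ B :=
    le_iSup₂ (f := fun k (_ : k ∈ spectrum ℂ B) => (‖k‖₊ : ℝ≥0∞)) μ hμ
  exact_mod_cast this.trans_lt h

/-- Root test: by Gelfand's formula the t-th roots of the terms tend to ρ(B)² q < 1. -/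
theorem summable_pow_mul_norm_pow_sq {B : Matrix (Fin n) (Fin n) ℂ} {q : ℝ} (hq : 0 ≤ q)
    (h : spectralRadius ℂ B ^ 2 * ENNReal.ofReal q < 1) :
    Summable fun t : ℕ => q ^ t * ‖B ^ t‖ ^ 2 := by
  obtain ⟨x, hx, hx1⟩ := exists_between h
  have hxtop : x ≠ ⊤ := (hx1.trans ENNReal.one_lt_top).ne
  have htend := ENNReal.Tendsto.mul_const (b := ENNReal.ofReal q)
    (ENNReal.Tendsto.pow (n := 2) (spectrum.pow_nnnorm_pow_one_div_tendsto_nhds_spectralRadius B))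
    (Or.inr ENNReal.ofReal_ne_top)
  have hev := htend.eventually_lt_const hx
  have hx1' : x.toReal < 1 := by
    simpa using (ENNReal.toReal_lt_toReal hxtop ENNReal.one_ne_top).2 hx1
  refine Summable.of_norm_bounded_eventually_nat
    (summable_geometric_of_lt_one ENNReal.toReal_nonneg hx1') ?_
  filter_upwards [hev, eventually_ne_atTop 0] with t ht ht0
  have h1 := pow_le_pow_left₀ (zero_le) ht.le t
  rw [mul_pow, ← pow_mul, mul_comm 2 t, pow_mul, ← ENNReal.rpow_natCast _ t, ← ENNReal.rpow_mul,
    one_div_mul_cancel (by exact_mod_cast ht0), ENNReal.rpow_one] at h1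
  have h2 := ENNReal.toReal_mono (ENNReal.pow_ne_top hxtop) h1
  rw [ENNReal.toReal_mul, ENNReal.toReal_pow, ENNReal.toReal_pow, ENNReal.toReal_pow,
    ENNReal.toReal_ofReal hq, ENNReal.coe_toReal, coe_nnnorm] at h2
  rw [Real.norm_of_nonneg (by positivity), mul_comm]
  exact h2

theorem summable_pow_mul_trace (D : Matrix (Fin n) (Fin n) ℝ) {q : ℝ} (hq : 0 ≤ q)
    (h : specRadius A ^ 2 * ENNReal.ofReal q < 1) :
    Summable fun t : ℕ => q ^ t * (A ^ t * D * Aᵀ ^ t).trace := by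
  have hs := (summable_pow_mul_norm_pow_sq hq h).mul_left (∑ i : Fin n, ∑ j, ∑ k, |D k j|)
  refine Summable.of_norm_bounded hs fun t => ?_
  have hentry : ∀ i j, |(A ^ t) i j| ≤ ‖A.map Complex.ofReal ^ t‖ := by
    intro i j
    have h1 := norm_entry_le_opNorm (A.map Complex.ofReal ^ t) i j
    have h2 : A.map Complex.ofReal ^ t = (A ^ t).map Complex.ofReal :=
      (map_pow Complex.ofRealHom.mapMatrix A t).symm
    rw [h2, Matrix.map_apply, Complex.norm_real] at h1
    rw [h2]
    exact h1
  set N := ‖A.map Complex.ofReal ^ t‖ with hN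
  rw [norm_mul, norm_pow, Real.norm_of_nonneg hq, mul_left_comm]
  refine mul_le_mul_of_nonneg_left ?_ (pow_nonneg hq t)
  simp only [Matrix.trace, Matrix.diag, Matrix.mul_apply, ← Matrix.transpose_pow,
    Matrix.transpose_apply, Finset.sum_mul, Real.norm_eq_abs]
  refine (Finset.abs_sum_le_sum_abs _ _).trans (Finset.sum_le_sum fun i _ => ?_)
  refine (Finset.abs_sum_le_sum_abs _ _).trans (Finset.sum_le_sum fun j _ => ?_)
  refine (Finset.abs_sum_le_sum_abs _ _).trans (Finset.sum_le_sum fun k _ => ?_)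
  rw [abs_mul, abs_mul]
  calc |(A ^ t) i k| * |D k j| * |(A ^ t) i j| ≤ N * |D k j| * N := by
        gcongr
        · exact hentry i k
        · exact hentry i j
    _ = _ := by ring

end Norm

/-- Exchanging sums, d s is weighted by the q^t with s < t < T, whose total is at most q^s times the
full geometric sum. No bound q < 1 enters, so r = 0 is covered. -/
theorem sum_pow_mul_le {e d : ℕ → ℝ} {q : ℝ} (hq0 : 0 ≤ q) (hd : ∀ t, 0 ≤ d t)
    (he : ∀ t, e (t + 1) = e t + d t) (T : ℕ) :
    ∑ t ∈ Finset.range T, q ^ t * e t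
      ≤ (e 0 + ∑ t ∈ Finset.range T, q ^ t * d t) * ∑ t ∈ Finset.range T, q ^ t := by
  induction T generalizing e d with
  | zero => simp
  | succ T ih =>
    have h1 := ih (e := fun t => e (t + 1)) (d := fun t => d (t + 1)) (fun t => hd (t + 1)) (fun t => he (t + 1))
    have hB : ∑ t ∈ Finset.range (T + 1), q ^ t = q * ∑ t ∈ Finset.range T, q ^ t + 1 := by
      rw [Finset.sum_range_succ', Finset.mul_sum]
      simp only [pow_succ', pow_zero]
    have hE : ∑ t ∈ Finset.range (T + 1), q ^ t * e t
        = q * ∑ t ∈ Finset.range T, q ^ t * e (t + 1) + e 0 := by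
      rw [Finset.sum_range_succ', Finset.mul_sum]
      simp only [pow_succ', pow_zero, mul_assoc, one_mul]
    have hD : ∑ t ∈ Finset.range (T + 1), q ^ t * d t
        = q * ∑ t ∈ Finset.range T, q ^ t * d (t + 1) + d 0 := by
      rw [Finset.sum_range_succ', Finset.mul_sum]
      simp only [pow_succ', pow_zero, mul_assoc, one_mul]
    have h2 := he 0
    simp only [zero_add] at h1 h2
    rw [hE, hB, hD]
    set b := ∑ t ∈ Finset.range T, q ^ t with hb
    set s := ∑ t ∈ Finset.range T, q ^ t * d (t + 1) with hs
    have hs0 : 0 ≤ s := Finset.sum_nonneg fun t _ => mul_nonneg (pow_nonneg hq0 t) (hd _)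
    rw [h2] at h1
    have h3 := mul_le_mul_of_nonneg_left h1 hq0
    have hb0 : 0 ≤ b := Finset.sum_nonneg fun t _ => pow_nonneg hq0 t
    have hb1 : b ≤ q * b + 1 := by
      rw [← hB, Finset.sum_range_succ]
      exact le_add_of_nonneg_right (pow_nonneg hq0 T)
    have h4 := mul_le_mul_of_nonneg_left hb1 (mul_nonneg hq0 hs0)
    nlinarith [hd 0]

theorem exists_sum_trace_remoteCov_le {q lam : ℝ} (hq0 : 0 ≤ q)
    (hD : (predictCov A W Pbar - Pbar).PosSemidef)
    (h : specRadius A ^ 2 * ENNReal.ofReal q < 1) :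
    ∃ J : ℝ, ∀ T, ∑ t ∈ Finset.range T, q ^ t * ((remoteCov A W Pbar t).trace + lam)
      ≤ J * ∑ t ∈ Finset.range T, q ^ t := by
  have hs := summable_pow_mul_trace (predictCov A W Pbar - Pbar) hq0 h
  set d : ℕ → ℝ := fun t => (A ^ t * (predictCov A W Pbar - Pbar) * Aᵀ ^ t).trace with hd
  have hd0 : ∀ t, 0 ≤ d t := fun t => (posSemidef_pow_mul_mul hD t).trace_nonneg
  refine ⟨(remoteCov A W Pbar 0).trace + lam + ∑' t, q ^ t * d t, fun T => ?_⟩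
  have h1 := sum_pow_mul_le (e := fun t => (remoteCov A W Pbar t).trace + lam) (d := d) hq0 hd0
    (fun t => by simp only [remoteCov_succ, Matrix.trace_add, hd]; ring) T
  refine h1.trans (mul_le_mul_of_nonneg_right ?_ (Finset.sum_nonneg fun t _ => pow_nonneg hq0 t))
  have h2 : ∑ t ∈ Finset.range T, q ^ t * d t ≤ ∑' t, q ^ t * d t :=
    hs.sum_le_tsum _ fun t _ => mul_nonneg (pow_nonneg hq0 t) (hd0 t)
  linarith

/-- Each trace is the squared Frobenius norm of A^t S; bounded partial sums force the terms to 0. -/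
theorem tendsto_pow_mul_apply_zero {S : Matrix (Fin n) (Fin n) ℝ} (hS : Sᵀ = S) {B : ℝ}
    (hB : ∀ τ, ∑ t ∈ Finset.range τ, (A ^ t * (S * S) * Aᵀ ^ t).trace ≤ B) (i j : Fin n) :
    Tendsto (fun t => (A ^ t * S) i j) atTop (𝓝 0) := by
  have htr : ∀ t, (A ^ t * (S * S) * Aᵀ ^ t).trace = ∑ i, ∑ j, (A ^ t * S) i j ^ 2 := by
    intro t
    have : A ^ t * (S * S) * Aᵀ ^ t = (A ^ t * S) * (A ^ t * S)ᵀ := by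
      rw [Matrix.transpose_mul, hS, Matrix.transpose_pow]
      simp only [Matrix.mul_assoc]
    rw [this]
    simp only [Matrix.trace, Matrix.diag, Matrix.mul_apply, Matrix.transpose_apply, sq]
  have hle : ∀ t, (A ^ t * S) i j ^ 2 ≤ (A ^ t * (S * S) * Aᵀ ^ t).trace := by
    intro t
    rw [htr]
    exact (Finset.single_le_sum (f := fun j => (A ^ t * S) i j ^ 2) (fun _ _ => sq_nonneg _)
      (Finset.mem_univ j)).trans (Finset.single_le_sum
        (f := fun i => ∑ j, (A ^ t * S) i j ^ 2)
        (fun _ _ => Finset.sum_nonneg fun _ _ => sq_nonneg _) (Finset.mem_univ i))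
  have hsum : Summable fun t => (A ^ t * (S * S) * Aᵀ ^ t).trace :=
    summable_of_sum_range_le (fun t => (sq_nonneg _).trans (hle t)) hB
  have hsq : Tendsto (fun t => (A ^ t * S) i j ^ 2) atTop (𝓝 0) :=
    squeeze_zero (fun t => sq_nonneg _) hle hsum.tendsto_atTop_zero
  have habs := hsq.sqrt
  simp only [Real.sqrt_sq_eq_abs, Real.sqrt_zero] at habs
  exact (tendsto_zero_iff_abs_tendsto_zero _).2 habs

/-- If the noise excites every mode that is not asymptotically stable and there is such a mode,
then the error covariance is unbounded. -/
theorem specRadius_lt_one_of_trace_le {S : Matrix (Fin n) (Fin n) ℝ} (hS : Sᵀ = S)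
    (hstab : Stabilizable A S) {B : ℝ}
    (hB : ∀ τ, ∑ t ∈ Finset.range τ, (A ^ t * (S * S) * Aᵀ ^ t).trace ≤ B) :
    specRadius A < 1 := by
  by_contra! hA
  obtain ⟨μ, hμ, hμ1⟩ := exists_mem_spectrum_of_one_le hA
  obtain ⟨v, hv, hvA⟩ := (mem_spectrum_iff_exists_vecMul _ _).1 hμ
  obtain ⟨K, hK⟩ := hstab
  have hvpow : ∀ t : ℕ, v ᵥ* A.map Complex.ofReal ^ t = μ ^ t • v := by
    intro t
    induction t with
    | zero => simp
    | succ t ih => rw [pow_succ, ← Matrix.vecMul_vecMul, ih, Matrix.smul_vecMul, hvA, smul_smul,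
        pow_succ]
  have hpow : ∀ t : ℕ, v ᵥ* (A ^ t * S).map Complex.ofReal
      = μ ^ t • (v ᵥ* S.map Complex.ofReal) := by
    intro t
    have h1 := map_mul Complex.ofRealHom.mapMatrix (A ^ t) S
    rw [map_pow] at h1
    have h2 : (A ^ t * S).map Complex.ofReal
        = A.map Complex.ofReal ^ t * S.map Complex.ofReal := h1
    rw [h2, ← Matrix.vecMul_vecMul, hvpow, Matrix.smul_vecMul]
  -- v A^t S = μ^t v S tends to 0 although |μ^t| ≥ 1.
  have hvS : v ᵥ* S.map Complex.ofReal = 0 := by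
    funext j
    have h1 : Tendsto (fun t : ℕ => (v ᵥ* (A ^ t * S).map Complex.ofReal) j) atTop (𝓝 0) := by
      have h2 : Tendsto (fun t : ℕ => ∑ i, v i * (((A ^ t * S) i j : ℝ) : ℂ)) atTop
          (𝓝 (∑ i, v i * ((0 : ℝ) : ℂ))) :=
        tendsto_finsetSum _ fun i _ => ((Complex.continuous_ofReal.tendsto 0).comp
          (tendsto_pow_mul_apply_zero hS hB i j)).const_mul _
      simpa [Matrix.vecMul, dotProduct] using h2
    have h3 := h1.norm
    rw [norm_zero] at h3
    have h4 : ‖(v ᵥ* S.map Complex.ofReal) j‖ ≤ 0 := by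
      refine ge_of_tendsto' h3 fun t => ?_
      rw [hpow, Pi.smul_apply, norm_smul, norm_pow]
      exact le_mul_of_one_le_left (norm_nonneg _) (one_le_pow₀ hμ1)
    simpa using norm_le_zero_iff.1 h4
  have hloop : (A + S * K).map Complex.ofReal
      = A.map Complex.ofReal + S.map Complex.ofReal * K.map Complex.ofReal := by
    have h1 := map_add Complex.ofRealHom.mapMatrix A (S * K)
    rw [map_mul] at h1
    exact h1
  -- Since v S = 0, feedback cannot move this mode: v remains a left eigenvector of A + S K for μ.
  refine absurd (norm_lt_one_of_mem_spectrum hK (μ := μ) ?_) (not_lt.2 hμ1)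
  rw [mem_spectrum_iff_exists_vecMul]
  refine ⟨v, hv, ?_⟩
  rw [hloop, Matrix.vecMul_add, ← Matrix.vecMul_vecMul, hvS, Matrix.zero_vecMul, add_zero, hvA]

end

/-! ### Structure of the optimal policy -/

theorem exists_thresholdRule_eq {g : ℕ → ℝ} (hg : Antitone g) :
    ∃ θ : ℕ∞, ∀ τ : ℕ, θ ≤ (τ : ℕ∞) ↔ g τ ≤ 0 := by
  classical
  by_cases h : ∃ τ, g τ ≤ 0
  · refine ⟨(Nat.find h : ℕ), fun τ => ?_⟩
    rw [Nat.cast_le]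
    exact ⟨fun hτ => (hg hτ).trans (Nat.find_spec h), fun hτ => Nat.find_min' h hτ⟩
  · push Not at h
    exact ⟨⊤, fun τ => by simp [h τ]⟩

section

variable {n : ℕ} {A W Pbar : Matrix (Fin n) (Fin n) ℝ} {lam : ℝ} {r : unitInterval} {J : ℝ}
  {V : ℕ → ℝ}

theorem qFactor_false (τ : ℕ) :
    qFactor A W Pbar lam r J V τ false = (remoteCov A W Pbar τ).trace + V (τ + 1) - J := by
  have h : ∀ s, V s * transProb r τ false s = if s = τ + 1 then V (τ + 1) else 0 := fun s => by
    by_cases hs : s = τ + 1 <;> simp [transProb, hs]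
  simp [qFactor, stageCost, actionValue, h]

theorem qFactor_true (τ : ℕ) :
    qFactor A W Pbar lam r J V τ true
      = (remoteCov A W Pbar τ).trace + lam + (r * V 0 + (1 - r) * V (τ + 1)) - J := by
  have h : ∑' s, V s * transProb r τ true s = r * V 0 + (1 - r) * V (τ + 1) := by
    rw [tsum_eq_sum (s := ({0, τ + 1} : Finset ℕ))]
    · rw [Finset.sum_pair (Nat.succ_ne_zero τ).symm]
      simp [transProb, mul_comm]
    · intro s hs
      simp only [Finset.mem_insert, Finset.mem_singleton, not_or] at hs
      simp [transProb, hs.1, hs.2]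
  simp [qFactor, stageCost, actionValue, h]

theorem min_qFactor (τ : ℕ) :
    min (qFactor A W Pbar lam r J V τ false) (qFactor A W Pbar lam r J V τ true)
      = (remoteCov A W Pbar τ).trace - J + contValue lam r (V 0) (V (τ + 1)) := by
  rw [qFactor_false, qFactor_true, contValue, ← min_add_add_left]
  congr 1 <;> ring

theorem isRelativeValue_iff :
    IsRelativeValue A W Pbar lam r J V ↔ BddBelow (Set.range V) ∧
      ∀ τ, V τ = (remoteCov A W Pbar τ).trace - J + contValue lam r (V 0) (V (τ + 1)) := by
  simp only [IsRelativeValue, min_qFactor]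

theorem qFactor_sub (τ : ℕ) :
    qFactor A W Pbar lam r J V τ true - qFactor A W Pbar lam r J V τ false
      = lam + (r : ℝ) * V 0 - (r : ℝ) * V (τ + 1) := by
  rw [qFactor_false, qFactor_true]
  ring

theorem IsRelativeValue.monotone (hV : IsRelativeValue A W Pbar lam r J V)
    (he : Monotone fun τ => (remoteCov A W Pbar τ).trace) : Monotone V :=
  monotone_of_bellman he r.2.1 r.2.2 hV.1 (isRelativeValue_iff.1 hV).2

theorem IsRelativeValue.antitone_qFactor_sub (hV : IsRelativeValue A W Pbar lam r J V)
    (he : Monotone fun τ => (remoteCov A W Pbar τ).trace) :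
    Antitone fun τ => qFactor A W Pbar lam r J V τ true - qFactor A W Pbar lam r J V τ false := by
  intro s t hst
  simp only [qFactor_sub]
  have := mul_le_mul_of_nonneg_left (hV.monotone he (Nat.succ_le_succ hst)) r.2.1
  linarith

theorem IsRelativeValue.eq_bellmanRule (hV : IsRelativeValue A W Pbar lam r J V) (τ : ℕ) :
    V τ = (remoteCov A W Pbar τ).trace + lam * actionValue (bellmanRule A W Pbar lam r J V τ)
      + (if bellmanRule A W Pbar lam r J V τ then r * V 0 + (1 - r) * V (τ + 1) else V (τ + 1))
      - J := by
  have h := hV.2 τ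
  by_cases hle : qFactor A W Pbar lam r J V τ true ≤ qFactor A W Pbar lam r J V τ false
  · rw [min_eq_right hle, qFactor_true] at h
    simpa [bellmanRule, hle, actionValue] using h
  · rw [min_eq_left (not_le.1 hle).le, qFactor_false] at h
    simpa [bellmanRule, hle, actionValue] using h

/-- If transmitting is never preferred, the error covariance stays bounded. -/
theorem IsRelativeValue.trace_remoteCov_le (hV : IsRelativeValue A W Pbar lam r J V)
    (he : Monotone fun τ => (remoteCov A W Pbar τ).trace)
    (h : ∀ τ, qFactor A W Pbar lam r J V τ false < qFactor A W Pbar lam r J V τ true) (τ : ℕ) :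
    (remoteCov A W Pbar τ).trace ≤ J := by
  have h1 := hV.2 τ
  rw [min_eq_left (h τ).le, qFactor_false] at h1
  have h2 : V τ ≤ V (τ + 1) := hV.monotone he (Nat.le_succ τ)
  linarith

end

end SensorScheduling

/-! ### Assembly of the theorem -/

open SensorScheduling

theorem theorem1 {n m : ℕ}
    (A : Matrix (Fin n) (Fin n) ℝ) (C : Matrix (Fin m) (Fin n) ℝ)
    (W : Matrix (Fin n) (Fin n) ℝ) (R : Matrix (Fin m) (Fin m) ℝ)
    (sqrtW Pbar : Matrix (Fin n) (Fin n) ℝ)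
    (hW : W.PosSemidef) (hR : R.PosDef)
    (hsqrt : sqrtW.PosSemidef) (hsqrtW : sqrtW * sqrtW = W)
    (hdet : SensorScheduling.Detectable A C)
    (hstab : SensorScheduling.Stabilizable A sqrtW)
    (hPbar : SensorScheduling.IsKalmanSteadyState A C W R Pbar)
    (lam : ℝ) (hlam : 0 ≤ lam) (r : unitInterval)
    (hr : SensorScheduling.specRadius A ^ 2 * ENNReal.ofReal (1 - (r : ℝ)) < 1) :
    ∃ J : ℝ, 0 ≤ J ∧
      -- `J` is the minimal value of the scheduling problem, in both of its forms
      IsLeast (Set.range (SensorScheduling.totalCost A W Pbar lam r)) (ENNReal.ofReal J) ∧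
      IsLeast (Set.range (SensorScheduling.mdpCost A W Pbar lam r)) (ENNReal.ofReal J) ∧
      -- the Bellman optimality equation with constant `J` is solvable
      (∃ V : ℕ → ℝ, SensorScheduling.IsRelativeValue A W Pbar lam r J V) ∧
      ∀ V : ℕ → ℝ, SensorScheduling.IsRelativeValue A W Pbar lam r J V →
        Monotone V ∧
        (∀ τ : ℕ, SensorScheduling.qFactor A W Pbar lam r J V τ true
            - SensorScheduling.qFactor A W Pbar lam r J V τ false
          = lam + (r : ℝ) * V 0 - (r : ℝ) * V (τ + 1)) ∧
        Antitone (fun τ : ℕ => SensorScheduling.qFactor A W Pbar lam r J V τ true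
            - SensorScheduling.qFactor A W Pbar lam r J V τ false) ∧
        ∃ θ : ℕ∞,
          -- the optimal policy is the threshold policy with threshold `θ`
          SensorScheduling.bellmanRule A W Pbar lam r J V = SensorScheduling.thresholdRule θ ∧
          SensorScheduling.totalCost A W Pbar lam r
              (SensorScheduling.stationary (SensorScheduling.thresholdRule θ))
            = ENNReal.ofReal J ∧
          SensorScheduling.mdpCost A W Pbar lam r
              (SensorScheduling.stationary (SensorScheduling.thresholdRule θ))
            = ENNReal.ofReal J ∧
          -- the threshold is finite if the process is not asymptotically stable
          (1 ≤ SensorScheduling.specRadius A → θ ≠ ⊤) := by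
  have hD := posSemidef_predictCov_sub hW hR hPbar
  have he := monotone_trace_remoteCov hD
  have hzero := trace_remoteCov_zero_nonneg (A := A) (W := W) hPbar.1
  have hpos : ∀ τ, 0 ≤ (remoteCov A W Pbar τ).trace := fun τ => hzero.trans (he (Nat.zero_le τ))
  have hr0 : (0 : ℝ) ≤ r := r.2.1
  have hr1 : (r : ℝ) ≤ 1 := r.2.2
  have hex : ∃ J, 0 ≤ J ∧ BellmanSolvable (fun τ => (remoteCov A W Pbar τ).trace) lam r J := by
    rcases hr1.lt_or_eq with h | h
    · exact exists_bellmanSolvable_of_lt_one he hzero hlam hr0 h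
        (exists_sum_trace_remoteCov_le (sub_nonneg.2 hr1) hD hr)
    · rw [h]
      exact exists_bellmanSolvable_one he hzero hlam
  obtain ⟨J, hJ, ⟨V₀, hV₀⟩, hsub⟩ := hex
  have hmdp : ∀ f, ENNReal.ofReal J ≤ mdpCost A W Pbar lam r f := fun f => by
    have hlt : ∀ J' < J, ENNReal.ofReal J' ≤ mdpCost A W Pbar lam r f := fun J' hJ' => by
      obtain ⟨u, ⟨B, hB⟩, hu⟩ := hsub J' hJ'
      exact ofReal_le_longRunAverage hB hu f
    exact le_of_tendsto (x := 𝓝[<] J)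
      ((ENNReal.continuous_ofReal.tendsto J).mono_left nhdsWithin_le_nhds)
      (eventually_nhdsWithin_of_forall hlt)
  have hle : ∀ f, mdpCost A W Pbar lam r f ≤ totalCost A W Pbar lam r f := fun f =>
    longRunAverage_add_mul_le hpos hlam f
  have hmain : ∀ V : ℕ → ℝ, IsRelativeValue A W Pbar lam r J V → ∃ θ : ℕ∞,
      bellmanRule A W Pbar lam r J V = thresholdRule θ ∧
      totalCost A W Pbar lam r (stationary (thresholdRule θ)) = ENNReal.ofReal J ∧
      mdpCost A W Pbar lam r (stationary (thresholdRule θ)) = ENNReal.ofReal J ∧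
      (1 ≤ specRadius A → θ ≠ ⊤) := by
    intro V hV
    obtain ⟨θ, hθ⟩ := exists_thresholdRule_eq (hV.antitone_qFactor_sub he)
    have hrule : bellmanRule A W Pbar lam r J V = thresholdRule θ := by
      funext τ
      simp only [bellmanRule, thresholdRule, hθ, sub_nonpos]
    obtain ⟨B, hB, hsum⟩ := exists_sum_expectAt_le hpos hlam hJ hV.1 hV.eq_bellmanRule
    rw [hrule] at hsum
    have hup : totalCost A W Pbar lam r (stationary (thresholdRule θ)) ≤ ENNReal.ofReal J :=
      longRunAverage_thresholdRule_le hpos hlam θ hB hsum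
    -- The chain J ≤ `mdpCost` ≤ `totalCost` ≤ J closes for the threshold policy.
    refine ⟨θ, hrule, hup.antisymm ((hmdp _).trans (hle _)),
      ((hle _).trans hup).antisymm (hmdp _), fun hA htop => ?_⟩
    have hnever : ∀ τ,
        qFactor A W Pbar lam r J V τ false < qFactor A W Pbar lam r J V τ true := fun τ => by
      have h := hθ τ
      simp only [htop, top_le_iff, ENat.natCast_ne_top, false_iff, sub_nonpos, not_le] at h
      exact h
    have hSt : sqrtWᵀ = sqrtW := by
      rw [← Matrix.conjTranspose_eq_transpose_of_trivial]; exact hsqrt.isHermitian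
    refine absurd (specRadius_lt_one_of_trace_le (B := J) hSt hstab fun τ => ?_) (not_lt.2 hA)
    rw [hsqrtW]
    exact (sum_trace_le_trace_remoteCov hPbar.1 τ).trans (hV.trace_remoteCov_le he hnever τ)
  have hrel : IsRelativeValue A W Pbar lam r J V₀ := isRelativeValue_iff.2 hV₀
  obtain ⟨θ₀, -, htot₀, hmdp₀, -⟩ := hmain V₀ hrel
  refine ⟨J, hJ, ⟨⟨_, htot₀⟩, ?_⟩, ⟨⟨_, hmdp₀⟩, ?_⟩, ⟨V₀, hrel⟩, fun V hV =>
    ⟨hV.monotone he, qFactor_sub, hV.antitone_qFactor_sub he, hmain V hV⟩⟩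
  · rintro _ ⟨f, rfl⟩
    exact (hmdp f).trans (hle f)
  · rintro _ ⟨f, rfl⟩
    exact hmdp f
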